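/- Let $X$ and $Y$ be irreducible affine varieties over $\mathbb{C}$ (reduced, of finite type), with coordinate rings $\mathcal{O}(X)$ and $\mathcal{O}(Y)$, and let $G$ be a finite group acting on $X$ by automorphisms of varieties over $\mathbb{C}$. Let $X/G=\operatorname{Spec}\,\mathcal{O}(X)^G$. For an affine variety $Z$ let $D(Z)=\bigcup_{n\ge 0}D(Z)_n\subseteq \operatorname{End}_{\mathbb{C}}(\mathcal{O}(Z))$ be its ring of differential operators, where $D(Z)_0=\mathcal{O}(Z)$ (acting by multiplication) and, for $n\ge 1$, $D(Z)_n=\{d\in\operatorname{End}_{\mathbb{C}}(\mathcal{O}(Z)) : db-bd\in D(Z)_{n-1}\text{ for all } b\in\mathcal{O}(Z)\}$. The group $G$ acts on $\mathcal{O}(X)$ by $\mathbb{C}$-algebra automorphisms and on $D(X)$ by $g*d=g\circ d\circ g^{-1}$; let $D(X)^G$ be the subring of $G$-invariant operators. Suppose that $X/G$ is birationally equivalent to $Y$ over $\mathbb{C}$, i.e. that $X/G$ and $Y$ have dense open subsets that are isomorphic over $\mathbb{C}$. Then $D(X)^G$ and $D(Y)$ are (left and right) Ore domains, and their skew fields of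 fractions are isomorphic as $\mathbb{C}$-algebras: $$\operatorname{Frac}\big(D(X)^G\big)\;\cong\;\operatorname{Frac}\big(D(Y)\big).$$ -/

import Mathlib

open scoped nonZeroDivisors

/-! ### Differential operators on a commutative algebra -/

section DiffOps

variable (k : Type*) [Field k] (A : Type*) [CommRing A] [Algebra k A]

/-- The `k`-linear differential operators of order at most `n` on `A`.  Order `0` means
multiplication by an element of `A`; `d` has order at most `n + 1` when every commutator
`d b - b d` with (multiplication by) `b : A` has order at most `n`. -/
def diffOpsOfOrder : ℕ → Set (Module.End k A)
  | 0 => Set.range (Algebra.lmul k A)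
  | n + 1 => {d | ∀ b : A,
      d * Algebra.lmul k A b - Algebra.lmul k A b * d ∈ diffOpsOfOrder n}

variable {k A}

theorem diffOpsOfOrder_add {n : ℕ} {d e : Module.End k A}
    (hd : d ∈ diffOpsOfOrder k A n) (he : e ∈ diffOpsOfOrder k A n) :
    d + e ∈ diffOpsOfOrder k A n := by
  induction n generalizing d e with
  | zero =>
    obtain ⟨a, rfl⟩ := hd
    obtain ⟨b, rfl⟩ := he
    exact ⟨a + b, map_add _ a b⟩
  | succ n ih =>
    intro b
    have h := ih (hd b) (he b)
    have heq : (d + e) * Algebra.lmul k A b - Algebra.lmul k A b * (d + e)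
        = (d * Algebra.lmul k A b - Algebra.lmul k A b * d)
          + (e * Algebra.lmul k A b - Algebra.lmul k A b * e) := by noncomm_ring
    rw [heq]
    exact h

theorem diffOpsOfOrder_lmul (n : ℕ) (a : A) :
    Algebra.lmul k A a ∈ diffOpsOfOrder k A n := by
  induction n generalizing a with
  | zero => exact ⟨a, rfl⟩
  | succ n ih =>
    intro b
    have heq : Algebra.lmul k A a * Algebra.lmul k A b - Algebra.lmul k A b * Algebra.lmul k A a
        = Algebra.lmul k A 0 := by
      rw [← map_mul, ← map_mul, mul_comm, sub_self, map_zero]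
    rw [heq]
    exact ih 0

theorem diffOpsOfOrder_succ {n : ℕ} {d : Module.End k A} (hd : d ∈ diffOpsOfOrder k A n) :
    d ∈ diffOpsOfOrder k A (n + 1) := by
  induction n generalizing d with
  | zero =>
    obtain ⟨a, rfl⟩ := hd
    exact diffOpsOfOrder_lmul 1 a
  | succ n ih => exact fun b => ih (hd b)

theorem diffOpsOfOrder_mono {m n : ℕ} (h : m ≤ n) {d : Module.End k A}
    (hd : d ∈ diffOpsOfOrder k A m) : d ∈ diffOpsOfOrder k A n := by
  induction h with
  | refl => exact hd
  | step _ ih => exact diffOpsOfOrder_succ ih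

theorem diffOpsOfOrder_mul (N : ℕ) {m n : ℕ} (hN : m + n = N) {d e : Module.End k A}
    (hd : d ∈ diffOpsOfOrder k A m) (he : e ∈ diffOpsOfOrder k A n) :
    d * e ∈ diffOpsOfOrder k A N := by
  induction N generalizing m n d e with
  | zero =>
    obtain ⟨rfl, rfl⟩ : m = 0 ∧ n = 0 := by omega
    obtain ⟨a, rfl⟩ := hd
    obtain ⟨b, rfl⟩ := he
    exact ⟨a * b, map_mul _ a b⟩
  | succ N ih =>
    intro b
    have heq : d * e * Algebra.lmul k A b - Algebra.lmul k A b * (d * e)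
        = d * (e * Algebra.lmul k A b - Algebra.lmul k A b * e)
          + (d * Algebra.lmul k A b - Algebra.lmul k A b * d) * e := by
      simp only [mul_sub, sub_mul, mul_assoc]
      abel
    have hzero : ∀ {f : Module.End k A}, f ∈ diffOpsOfOrder k A 0 →
        f * Algebra.lmul k A b - Algebra.lmul k A b * f = 0 := by
      rintro _ ⟨a, rfl⟩
      rw [← map_mul, ← map_mul, mul_comm, sub_self]
    have h0 : (0 : Module.End k A) ∈ diffOpsOfOrder k A N := by
      simpa using diffOpsOfOrder_lmul (k := k) N (0 : A)
    rw [heq]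
    refine diffOpsOfOrder_add ?_ ?_
    · cases n with
      | zero => rw [hzero he, mul_zero]; exact h0
      | succ n => exact ih (by omega) hd (he b)
    · cases m with
      | zero => rw [hzero hd, zero_mul]; exact h0
      | succ m => exact ih (by omega) (hd b) he

variable (k A)

/-- The ring `D(X)` of differential operators on `X = Spec A`, as a subalgebra of `End_k(A)`:
the union of the sets of operators of order at most `n`. -/
def diffOps : Subalgebra k (Module.End k A) where
  carrier := {d | ∃ n, d ∈ diffOpsOfOrder k A n}
  mul_mem' := by
    rintro d e ⟨m, hd⟩ ⟨n, he⟩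
    exact ⟨m + n, diffOpsOfOrder_mul _ rfl hd he⟩
  add_mem' := by
    rintro d e ⟨m, hd⟩ ⟨n, he⟩
    exact ⟨max m n, diffOpsOfOrder_add (diffOpsOfOrder_mono (le_max_left m n) hd)
      (diffOpsOfOrder_mono (le_max_right m n) he)⟩
  algebraMap_mem' := fun r => ⟨0, algebraMap k A r, (Algebra.lmul k A).commutes r⟩

variable {k A} {G : Type*} [Group G]

/-- The coordinate ring `A^G` of the quotient `X/G`, where `X = Spec A`. -/
def invariantFunctions (ρ : G →* (A ≃ₐ[k] A)) : Subalgebra k A where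
  carrier := {a | ∀ g, ρ g a = a}
  mul_mem' := fun {a b} ha hb g => by rw [map_mul, ha g, hb g]
  add_mem' := fun {a b} ha hb g => by rw [map_add, ha g, hb g]
  algebraMap_mem' := fun r g => (ρ g).commutes r

/-- The ring `D(X)^G` of differential operators fixed by the action
`g * d = g ∘ d ∘ g⁻¹` of `G` on `D(X)`. -/
def invariantDiffOps (ρ : G →* (A ≃ₐ[k] A)) : Subalgebra k (Module.End k A) where
  carrier := {d | d ∈ diffOps k A ∧
    ∀ g, (ρ g).toLinearMap ∘ₗ d ∘ₗ (ρ g⁻¹).toLinearMap = d}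
  mul_mem' := by
    rintro d e ⟨hd', hd⟩ ⟨he', he⟩
    refine ⟨mul_mem hd' he', fun g => ?_⟩
    ext a
    have h1 := LinearMap.congr_fun (hd g) (e a)
    have h2 := LinearMap.congr_fun (he g) a
    simp only [LinearMap.comp_apply, AlgEquiv.toLinearMap_apply, map_inv,
      Module.End.mul_apply] at h1 h2 ⊢
    rw [← h1, ← h2]
    simp [AlgEquiv.aut_inv]
  add_mem' := by
    rintro d e ⟨hd', hd⟩ ⟨he', he⟩
    refine ⟨add_mem hd' he', fun g => ?_⟩
    rw [LinearMap.add_comp, LinearMap.comp_add, hd g, he g]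
  algebraMap_mem' := by
    refine fun r => ⟨algebraMap_mem _ r, fun g => ?_⟩
    ext a
    simp [Module.algebraMap_end_apply, AlgEquiv.aut_inv]

end DiffOps

/-! ### Ore domains and their skew fields of fractions -/

/-- A (left and right) Ore domain. -/
class IsOreDomain (R : Type*) [Ring R] : Prop extends IsDomain R where
  left_ore : ∀ a b : R, b ≠ 0 → ∃ r s : R, s ≠ 0 ∧ s * a = r * b
  right_ore : ∀ a b : R, b ≠ 0 → ∃ r s : R, s ≠ 0 ∧ a * s = b * r

theorem IsOreDomain.nonempty_oreSet (R : Type*) [Ring R] [IsOreDomain R] :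
    Nonempty (OreLocalization.OreSet R⁰) := by
  rw [OreLocalization.nonempty_oreSet_iff_of_noZeroDivisors]
  intro r s
  obtain ⟨r', s', hs', h⟩ := IsOreDomain.left_ore r (s : R) (nonZeroDivisors.coe_ne_zero s)
  exact ⟨r', ⟨s', mem_nonZeroDivisors_of_ne_zero hs'⟩, h⟩

/-- The skew field of fractions `Frac R` of an Ore domain: the Ore localization of `R` at its
nonzero elements. -/
abbrev SkewFrac (R : Type*) [Ring R] [IsOreDomain R] : Type _ :=
  @OreLocalization R _ R⁰ (IsOreDomain.nonempty_oreSet R).some R _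

/-! ### Birational equivalence -/

open CategoryTheory AlgebraicGeometry in
/-- Two schemes `X`, `Y` over `S` are birationally equivalent if they have isomorphic (over `S`)
dense open subschemes. -/
def BirationallyEquivalent {S X Y : Scheme} (p : X ⟶ S) (q : Y ⟶ S) : Prop :=
  ∃ (U : X.Opens) (V : Y.Opens), Dense (U : Set X) ∧ Dense (V : Set Y) ∧
    ∃ e : U.toScheme ≅ V.toScheme, e.hom ≫ V.ι ≫ q = U.ι ≫ p

open CategoryTheory AlgebraicGeometry in
/-- The structure morphism `Spec A ⟶ Spec ℂ` of a complex affine scheme. -/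
noncomputable def complexSpec (A : Type) [CommRing A] [Algebra ℂ A] :
    Spec (CommRingCat.of A) ⟶ Spec (CommRingCat.of ℂ) :=
  Spec.map (CommRingCat.ofHom (algebraMap ℂ A))

/-!
Let `K = Frac A`, with the induced action of `G`. The skew fields of fractions of `D(A)^G` and
`D(B)` are both identified with that of `D(K)^G`.

A birational equivalence between `Spec A^G` and `Spec B` gives a common fraction field `M` of `A^G`
and `B`, namely the stalk at the generic point of the common open subscheme
(`exists_common_fractionField`). It embeds into `K` with image `K^G`, because a fraction of
elements of `A` that is invariant has an invariant denominator (`exists_invariant_fraction`). Since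
`K` is integral over `K^G` and the characteristic is zero, both `A → K` and `B → M → K` are
formally étale.

Along a formally étale map `B → K` a differential operator extends uniquely. Existence
(`exists_extension`): the identity of `K` lifts through the nilpotent thickening
`(K ⊗ B) ⧸ I ^ (n + 1)` of `K`, on which an operator of order `n` is a linear form. Uniqueness
(`eq_zero_of_vanishing`): an operator commuting with `B` is a multiplication operator, as `K` has
no `B`-derivations. So `D(A)^G` and `D(B)` embed into `D(K)^G`. As `A` and `B` are finitely
generated, an operator in `D(K)^G` maps `A`, respectively `B`, into itself after multiplication by
one nonzero element (`exists_smul_preserves`), which for `A` can be replaced by its norm. Such an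
embedding of Ore domains induces an isomorphism of skew fields of fractions
(`nonempty_skewFrac_algEquiv`).

The Ore property holds for all three rings by `isOreDomain_of_derivations`: the commutators with
finitely many functions generating `M` are commuting locally nilpotent derivations, whose common
constants are multiplication operators. The Ore property ascends from the constants of a locally
nilpotent derivation to the whole ring by a Euclidean algorithm on degrees; in a torsion-free ring
leading coefficients multiply up to a nonzero integer, so there are no zero divisors either.
-/

open scoped TensorProduct

/-! ### Ore domains from locally nilpotent derivations -/

section LocallyNilpotent

variable {R : Type*} [Ring R]

/-- `a` has degree exactly `n` for the locally nilpotent map `δ`: `n` is the last exponent with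
`δ^n a ≠ 0`. The element `δ^n a`, killed by `δ`, plays the role of a leading coefficient. -/
def HasNilDegree (δ : R →+ R) (a : R) (n : ℕ) : Prop :=
  δ^[n] a ≠ 0 ∧ δ^[n + 1] a = 0

theorem exists_hasNilDegree {δ : R →+ R} {a : R} {N : ℕ} (h : δ^[N] a = 0) (ha : a ≠ 0) :
    ∃ n < N, HasNilDegree δ a n := by
  induction N with
  | zero => exact absurd h ha
  | succ N ih =>
    by_cases h' : δ^[N] a = 0
    · obtain ⟨n, hn, h⟩ := ih h'
      exact ⟨n, by omega, h⟩
    · exact ⟨N, by omega, h', h⟩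

theorem iterate_mul_left {δ : R →+ R} (leib : ∀ a b, δ (a * b) = δ a * b + a * δ b) {c : R}
    (hc : δ c = 0) (a : R) (n : ℕ) : δ^[n] (c * a) = c * δ^[n] a := by
  induction n with
  | zero => rfl
  | succ n ih => rw [Function.iterate_succ_apply', ih, leib, hc, zero_mul, zero_add,
      Function.iterate_succ_apply']

theorem iterate_mul_right {δ : R →+ R} (leib : ∀ a b, δ (a * b) = δ a * b + a * δ b) {c : R}
    (hc : δ c = 0) (a : R) (n : ℕ) : δ^[n] (a * c) = δ^[n] a * c := by
  induction n with
  | zero => rfl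
  | succ n ih => rw [Function.iterate_succ_apply', ih, leib, hc, mul_zero, add_zero,
      Function.iterate_succ_apply']

/-- The top term of the Leibniz rule: only one summand of `δ^(m + n) (a * b)` survives when
`δ^(m + 1) a = 0` and `δ^(n + 1) b = 0`. -/
theorem iterate_add_mul {δ : R →+ R} (leib : ∀ a b, δ (a * b) = δ a * b + a * δ b)
    (N : ℕ) : ∀ (m n : ℕ), m + n = N → ∀ a b : R, δ^[m + 1] a = 0 → δ^[n + 1] b = 0 →
      δ^[N] (a * b) = (m + n).choose m • (δ^[m] a * δ^[n] b) := by
  induction N with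
  | zero =>
    intro m n h a b _ _
    obtain ⟨rfl, rfl⟩ : m = 0 ∧ n = 0 := by omega
    simp
  | succ N ih =>
    rintro (_ | m) (_ | n) h a b ha hb
    · omega
    · obtain rfl : n = N := by omega
      rw [iterate_mul_left leib (by simpa using ha)]
      simp
    · obtain rfl : m = N := by omega
      rw [iterate_mul_right leib (by simpa using hb)]
      simp
    · have h1 := ih m (n + 1) (by omega) (δ a) b ha hb
      have h2 := ih (m + 1) n (by omega) a (δ b) ha hb
      rw [Function.iterate_succ_apply, leib, iterate_map_add, h1, h2,
        show m + 1 + (n + 1) = (m + (n + 1)) + 1 by omega, Nat.choose_succ_succ, add_smul,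
        show m + 1 + n = m + (n + 1) by omega]
      rfl

theorem iterate_succ_mul_eq_zero {δ : R →+ R} (leib : ∀ a b, δ (a * b) = δ a * b + a * δ b)
    (m n : ℕ) (a b : R) (ha : δ^[m + 1] a = 0) (hb : δ^[n + 1] b = 0) :
    δ^[m + n + 1] (a * b) = 0 := by
  rw [Function.iterate_succ_apply', iterate_add_mul leib _ m n rfl a b ha hb, map_nsmul, leib,
    ← Function.iterate_succ_apply' δ, ← Function.iterate_succ_apply' δ, ha, hb]
  simp

/-- The subring `S` has no zero divisors and any two of its nonzero elements have a nonzero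
common left multiple in `S`. This is phrased inside a fixed ambient ring so that it can be passed
along a chain of subrings. -/
structure IsLeftOreSubring (S : Subring R) : Prop where
  mul_ne_zero : ∀ a ∈ S, ∀ b ∈ S, a ≠ 0 → b ≠ 0 → a * b ≠ 0
  exists_common : ∀ a ∈ S, ∀ b ∈ S, a ≠ 0 → b ≠ 0 → ∃ r ∈ S, ∃ s ∈ S, s ≠ 0 ∧ s * a = r * b

variable [IsAddTorsionFree R]

/-- Degrees add up if the constants of `δ` in `S` have no zero divisors: the leading coefficient of
`a * b` is a binomial coefficient times the product of the leading coefficients. -/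
theorem HasNilDegree.mul {δ : R →+ R} (leib : ∀ a b, δ (a * b) = δ a * b + a * δ b)
    {S C : Subring R} (hS : ∀ a ∈ S, δ a ∈ S) (hC : ∀ a ∈ S, δ a = 0 → a ∈ C)
    (dom : ∀ a ∈ C, ∀ b ∈ C, a ≠ 0 → b ≠ 0 → a * b ≠ 0)
    {a b : R} (haS : a ∈ S) (hbS : b ∈ S) {m n : ℕ}
    (ha : HasNilDegree δ a m) (hb : HasNilDegree δ b n) : HasNilDegree δ (a * b) (m + n) := by
  have hit : ∀ a ∈ S, ∀ n, δ^[n] a ∈ S := fun a ha n => by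
    induction n with
    | zero => exact ha
    | succ n ih => rw [Function.iterate_succ_apply']; exact hS _ ih
  refine ⟨?_, iterate_succ_mul_eq_zero leib m n a b ha.2 hb.2⟩
  rw [iterate_add_mul leib _ m n rfl a b ha.2 hb.2]
  refine smul_ne_zero (Nat.choose_pos (by omega)).ne' (dom _ ?_ _ ?_ ha.1 hb.1)
  · exact hC _ (hit a haS m) (by rw [← Function.iterate_succ_apply' δ]; exact ha.2)
  · exact hC _ (hit b hbS n) (by rw [← Function.iterate_succ_apply' δ]; exact hb.2)

/-- The left Ore property ascends from the constants `C` of a locally nilpotent derivation of `S` to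
`S`. As in the Euclidean algorithm, a left combination of `a` and a left multiple of `b` cancels the
leading coefficients, which have a common left multiple in `C`; induct on the sum of the degrees. -/
theorem IsLeftOreSubring.of_derivation {δ : R →+ R}
    (leib : ∀ a b, δ (a * b) = δ a * b + a * δ b)
    {S C : Subring R} (hS : ∀ a ∈ S, δ a ∈ S) (hC : ∀ a, a ∈ C ↔ a ∈ S ∧ δ a = 0)
    (nil : ∀ a ∈ S, ∃ n, δ^[n] a = 0) (h : IsLeftOreSubring C) : IsLeftOreSubring S := by
  have hC' : ∀ a ∈ S, δ a = 0 → a ∈ C := fun a h h' => (hC a).2 ⟨h, h'⟩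
  have hit : ∀ a ∈ S, ∀ n, δ^[n] a ∈ S := fun a ha n => by
    induction n with
    | zero => exact ha
    | succ n ih => rw [Function.iterate_succ_apply']; exact hS _ ih
  have hdeg : ∀ a ∈ S, a ≠ 0 → ∃ n, HasNilDegree δ a n := fun a ha h0 => by
    obtain ⟨N, hN⟩ := nil a ha
    obtain ⟨n, _, hn⟩ := exists_hasNilDegree hN h0
    exact ⟨n, hn⟩
  have hmul : ∀ {a b : R} {m n : ℕ}, a ∈ S → b ∈ S → HasNilDegree δ a m → HasNilDegree δ b n →
      HasNilDegree δ (a * b) (m + n) := fun ha hb =>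
    HasNilDegree.mul leib hS hC' h.mul_ne_zero ha hb
  have dom : ∀ a ∈ S, ∀ b ∈ S, a ≠ 0 → b ≠ 0 → a * b ≠ 0 := by
    intro a ha b hb ha0 hb0 h0
    obtain ⟨m, hm⟩ := hdeg a ha ha0
    obtain ⟨n, hn⟩ := hdeg b hb hb0
    exact (hmul ha hb hm hn).1 (by rw [h0, iterate_map_zero])
  refine ⟨dom, ?_⟩
  suffices H : ∀ N m n : ℕ, m + n = N → ∀ a ∈ S, ∀ b ∈ S, HasNilDegree δ a m →
      HasNilDegree δ b n → ∃ r ∈ S, ∃ s ∈ S, s ≠ 0 ∧ r ≠ 0 ∧ s * a = r * b by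
    intro a ha b hb ha0 hb0
    obtain ⟨m, hm⟩ := hdeg a ha ha0
    obtain ⟨n, hn⟩ := hdeg b hb hb0
    obtain ⟨r, hr, s, hs, hs0, _, e⟩ := H _ m n rfl a ha b hb hm hn
    exact ⟨r, hr, s, hs, hs0, e⟩
  intro N
  induction N using Nat.strong_induction_on with
  | _ N ih =>
  -- Both entries play symmetric roles, so `a` may be taken of the larger degree.
  suffices H : ∀ m n : ℕ, m + n = N → n ≤ m → ∀ a ∈ S, ∀ b ∈ S, HasNilDegree δ a m →
      HasNilDegree δ b n → ∃ r ∈ S, ∃ s ∈ S, s ≠ 0 ∧ r ≠ 0 ∧ s * a = r * b by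
    intro m n hN a ha b hb hm hn
    rcases le_total n m with hle | hle
    · exact H m n hN hle a ha b hb hm hn
    · obtain ⟨r, hr, s, hs, hs0, hr0, e⟩ := H n m (by omega) hle b hb a ha hn hm
      exact ⟨s, hs, r, hr, hr0, hs0, e.symm⟩
  intro m n hN hle a ha b hb hm hn
  have ne0 : ∀ {c : R} {k : ℕ}, HasNilDegree δ c k → c ≠ 0 := fun hk h0 =>
    hk.1 (by rw [h0, iterate_map_zero])
  -- A left multiple `p * b` of degree `m`, where `p` is a power of the element `δ^(m - 1) a` of
  -- degree one.
  obtain ⟨p, hp, hpm⟩ : ∃ p ∈ S, HasNilDegree δ (p * b) m := by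
    rcases Nat.eq_zero_or_pos m with rfl | hpos
    · obtain rfl : n = 0 := by omega
      exact ⟨1, S.one_mem, by rwa [one_mul]⟩
    · obtain ⟨m, rfl⟩ : ∃ m', m = m' + 1 := ⟨m - 1, by omega⟩
      have hy : HasNilDegree δ (δ^[m] a) 1 := by
        refine ⟨?_, ?_⟩
        · rw [← Function.iterate_add_apply, add_comm]; exact hm.1
        · rw [← Function.iterate_add_apply, show 1 + 1 + m = m + 1 + 1 by omega]; exact hm.2
      have hyj : ∀ j, HasNilDegree δ ((δ^[m] a) ^ j * b) (j + n) := by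
        intro j
        induction j with
        | zero => simpa using hn
        | succ j ihj =>
          rw [pow_succ', mul_assoc, show j + 1 + n = 1 + (j + n) by omega]
          exact hmul (hit a ha m) (S.mul_mem (S.pow_mem (hit a ha m) j) hb) hy ihj
      refine ⟨_, S.pow_mem (hit a ha m) (m + 1 - n), ?_⟩
      have := hyj (m + 1 - n)
      rwa [Nat.sub_add_cancel hle] at this
  have hpb : p * b ∈ S := S.mul_mem hp hb
  have hp0 : p ≠ 0 := fun h0 => ne0 hpm (by rw [h0, zero_mul])
  have lead : ∀ {c : R} {k : ℕ}, c ∈ S → HasNilDegree δ c k → δ^[k] c ∈ C := fun hc hk =>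
    hC' _ (hit _ hc _) (by rw [← Function.iterate_succ_apply' δ]; exact hk.2)
  obtain ⟨r, hr, s, hs, hs0, e⟩ := h.exists_common _ (lead ha hm) _ (lead hpb hpm) hm.1 hpm.1
  have hrS := ((hC r).1 hr).1
  have hsS := ((hC s).1 hs).1
  have hlow : δ^[m] (s * a - r * (p * b)) = 0 := by
    rw [iterate_map_sub, iterate_mul_left leib ((hC s).1 hs).2,
      iterate_mul_left leib ((hC r).1 hr).2, e, sub_self]
  by_cases h0 : s * a - r * (p * b) = 0
  · rw [sub_eq_zero, ← mul_assoc] at h0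
    refine ⟨r * p, S.mul_mem hrS hp, s, hsS, hs0, fun h1 => ?_, h0⟩
    rw [h1, zero_mul] at h0
    exact dom s hsS a ha hs0 (ne0 hm) h0
  · obtain ⟨m', hm', hdeg'⟩ := exists_hasNilDegree hlow h0
    have hmem : s * a - r * (p * b) ∈ S :=
      S.sub_mem (S.mul_mem hsS ha) (S.mul_mem hrS hpb)
    obtain ⟨v, hv, u, hu, hu0, -, e'⟩ := ih (m' + n) (by omega) m' n rfl _ hmem b hb hdeg' hn
    have e2 : u * s * a = (v + u * r * p) * b := by
      rw [add_mul, ← e']; noncomm_ring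
    have hus : u * s ≠ 0 := dom u hu s hsS hu0 hs0
    refine ⟨v + u * r * p, S.add_mem hv (S.mul_mem (S.mul_mem hu hrS) hp), u * s,
      S.mul_mem hu hsS, hus, fun h1 => ?_, e2⟩
    rw [h1, zero_mul] at e2
    exact dom _ (S.mul_mem hu hsS) a ha hus (ne0 hm) e2

/-- The elements killed by the derivations `δ i`, `i ∈ t`. -/
def derivationConstants {ι : Type*} (δ : ι → R →+ R)
    (leib : ∀ i a b, δ i (a * b) = δ i a * b + a * δ i b) (t : Finset ι) : Subring R where
  carrier := {a | ∀ i ∈ t, δ i a = 0}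
  mul_mem' := fun ha hb i hi => by rw [leib, ha i hi, hb i hi, zero_mul, mul_zero, add_zero]
  one_mem' := fun i _ => by
    have := leib i 1 1
    simpa using this
  add_mem' := fun ha hb i hi => by rw [map_add, ha i hi, hb i hi, add_zero]
  zero_mem' := fun i _ => map_zero _
  neg_mem' := fun ha i hi => by rw [map_neg, ha i hi, neg_zero]

/-- The chain of constants of the first, the first two, … derivations ends at a commutative domain,
which is trivially Ore. -/
theorem isLeftOreSubring_top_of_derivations {ι : Type*} [Finite ι] (δ : ι → R →+ R)
    (leib : ∀ i a b, δ i (a * b) = δ i a * b + a * δ i b)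
    (comm : ∀ i j a, δ i (δ j a) = δ j (δ i a))
    (nil : ∀ i a, ∃ n, (δ i)^[n] a = 0)
    (hcomm : ∀ a b, (∀ i, δ i a = 0) → (∀ i, δ i b = 0) → a * b = b * a)
    (hdom : ∀ a b, (∀ i, δ i a = 0) → (∀ i, δ i b = 0) → a ≠ 0 → b ≠ 0 → a * b ≠ 0) :
    IsLeftOreSubring (⊤ : Subring R) := by
  classical
  cases nonempty_fintype ι
  have key : ∀ t : Finset ι, IsLeftOreSubring (derivationConstants δ leib t) →
      IsLeftOreSubring (⊤ : Subring R) := by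
    intro t
    induction t using Finset.induction_on with
    | empty =>
      intro h
      convert h
      ext a
      simp [derivationConstants]
    | insert i t _ ih =>
      intro h
      refine ih (h.of_derivation (leib i) (fun a ha j hj => ?_) (fun a => ?_) fun a _ => nil i a)
      · rw [comm, ha j hj, map_zero]
      · change (∀ j ∈ insert i t, δ j a = 0) ↔ (∀ j ∈ t, δ j a = 0) ∧ δ i a = 0
        rw [Finset.forall_mem_insert, and_comm]
  refine key Finset.univ ⟨fun a ha b hb => hdom a b (fun i => ha i (Finset.mem_univ i))
    fun i => hb i (Finset.mem_univ i), fun a ha b hb _ hb0 => ⟨a, ha, b, hb, hb0, ?_⟩⟩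
  exact hcomm b a (fun i => hb i (Finset.mem_univ i)) fun i => ha i (Finset.mem_univ i)

open MulOpposite in
/-- A ring with finitely many commuting locally nilpotent derivations whose common constants form a
commutative domain is an Ore domain. Right multiples are obtained from left multiples in the
opposite ring. -/
theorem isOreDomain_of_derivations [Nontrivial R] {ι : Type*} [Finite ι] (δ : ι → R →+ R)
    (leib : ∀ i a b, δ i (a * b) = δ i a * b + a * δ i b)
    (comm : ∀ i j a, δ i (δ j a) = δ j (δ i a))
    (nil : ∀ i a, ∃ n, (δ i)^[n] a = 0)
    (hcomm : ∀ a b, (∀ i, δ i a = 0) → (∀ i, δ i b = 0) → a * b = b * a)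
    (hdom : ∀ a b, (∀ i, δ i a = 0) → (∀ i, δ i b = 0) → a ≠ 0 → b ≠ 0 → a * b ≠ 0) :
    IsOreDomain R := by
  have hl := isLeftOreSubring_top_of_derivations δ leib comm nil hcomm hdom
  let δ' : ι → Rᵐᵒᵖ →+ Rᵐᵒᵖ := fun i =>
    (opAddEquiv.toAddMonoidHom.comp (δ i)).comp opAddEquiv.symm.toAddMonoidHom
  have hδ' : ∀ i a, δ' i a = op (δ i (unop a)) := fun i a => rfl
  have hz : ∀ a : Rᵐᵒᵖ, (∀ i, δ' i a = 0) → ∀ i, δ i (unop a) = 0 := fun a h i => by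
    simpa [hδ'] using h i
  have : IsAddTorsionFree Rᵐᵒᵖ := ⟨fun n hn a b h => by
    apply unop_injective
    exact IsAddTorsionFree.nsmul_right_injective hn (congrArg unop h)⟩
  have hr : IsLeftOreSubring (⊤ : Subring Rᵐᵒᵖ) := by
    refine isLeftOreSubring_top_of_derivations δ' ?_ ?_ ?_ ?_ ?_
    · intro i a b
      apply unop_injective
      simp [hδ', leib, add_comm]
    · intro i j a
      simp [hδ', comm i j]
    · intro i a
      obtain ⟨n, hn⟩ := nil i (unop a)
      refine ⟨n, ?_⟩
      have : ∀ n, (δ' i)^[n] a = op ((δ i)^[n] (unop a)) := by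
        intro n
        induction n with
        | zero => rfl
        | succ n ih => rw [Function.iterate_succ_apply', ih, hδ', Function.iterate_succ_apply',
            unop_op]
      rw [this, hn, op_zero]
    · intro a b ha hb
      apply unop_injective
      exact hcomm _ _ (hz b hb) (hz a ha)
    · intro a b ha hb ha0 hb0 h
      exact hdom _ _ (hz b hb) (hz a ha) (by simpa using hb0) (by simpa using ha0)
        (by simpa using congrArg unop h)
  have : NoZeroDivisors R := ⟨fun {a b} h => by
    by_contra! hne
    exact hl.mul_ne_zero a trivial b trivial hne.1 hne.2 h⟩
  have : IsDomain R := NoZeroDivisors.to_isDomain R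
  refine { left_ore := fun a b hb => ?_, right_ore := fun a b hb => ?_ }
  · by_cases ha : a = 0
    · exact ⟨0, 1, one_ne_zero, by simp [ha]⟩
    · obtain ⟨r, -, s, -, hs, e⟩ := hl.exists_common a trivial b trivial ha hb
      exact ⟨r, s, hs, e⟩
  · by_cases ha : a = 0
    · exact ⟨0, 1, one_ne_zero, by simp [ha]⟩
    · obtain ⟨r, -, s, -, hs, e⟩ := hr.exists_common (op a) trivial (op b) trivial
        (by simpa using ha) (by simpa using hb)
      exact ⟨unop r, unop s, by simpa using hs, by simpa using congrArg unop e⟩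

end LocallyNilpotent

/-! ### Comparison of skew fields of fractions -/

section SkewFrac

/-- An embedding `R → S` of Ore domains induces an isomorphism of skew fields of fractions as soon
as left denominators from `R` clear every element of `S` into `R`. -/
theorem nonempty_skewFrac_algEquiv {k R S : Type*} [Field k] [Ring R] [Ring S] [Algebra k R]
    [Algebra k S] [IsOreDomain R] [IsOreDomain S] (f : R →ₐ[k] S) (hf : Function.Injective f)
    (h : ∀ s : S, ∃ r r' : R, r ≠ 0 ∧ f r * s = f r') :
    Nonempty (SkewFrac R ≃ₐ[k] SkewFrac S) := by
  let _ := (IsOreDomain.nonempty_oreSet R).some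
  let _ := (IsOreDomain.nonempty_oreSet S).some
  let ιS : S →+* OreLocalization S⁰ S := OreLocalization.numeratorRingHom
  have hιS : Function.Injective ιS :=
    OreLocalization.numeratorHom_inj fun _ h => h.1
  let g : R →+* OreLocalization S⁰ S := ιS.comp (f : R →+* S)
  have hg0 : ∀ r : R, r ≠ 0 → g r ≠ 0 := fun r hr h0 =>
    hr (hf (hιS (by simpa [g] using h0)))
  let u : R⁰ →* (OreLocalization S⁰ S)ˣ :=
    Units.liftRight ((g : R →* OreLocalization S⁰ S).comp R⁰.subtype)
      (fun r => Units.mk0 _ (hg0 r (nonZeroDivisors.coe_ne_zero r))) (fun r => rfl)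
  let F : OreLocalization R⁰ R →+* OreLocalization S⁰ S :=
    OreLocalization.universalHom g u (fun r => rfl)
  have hFn : ∀ r, F (OreLocalization.numeratorHom r) = g r := fun r =>
    OreLocalization.universalHom_commutes ..
  have hF : Function.Bijective F := by
    refine ⟨F.injective, fun x => ?_⟩
    induction x using OreLocalization.ind with | _ t s
    have hx : ιS (s : S) * (t /ₒ s) = ιS t := OreLocalization.mul_cancel
    obtain ⟨r, r', hr, e⟩ := h s
    obtain ⟨r₁, r₂, hr₁, e₁⟩ := h (f r * t)
    have hr' : r' ≠ 0 := fun h0 => by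
      rw [h0, map_zero] at e
      exact mul_ne_zero ((map_ne_zero_iff f hf).2 hr) (nonZeroDivisors.coe_ne_zero s) e
    have key : g (r₁ * r') * (t /ₒ s) = g r₂ := by
      have h1 : g (r₁ * r') = ιS (f r₁) * ιS (f r) * ιS s := by
        simp only [g, RingHom.comp_apply, RingHom.coe_coe, map_mul, ← e, mul_assoc]
      rw [h1, mul_assoc, hx, mul_assoc, ← map_mul, ← map_mul, e₁]
      rfl
    refine ⟨(OreLocalization.numeratorHom (r₁ * r'))⁻¹ * OreLocalization.numeratorHom r₂, ?_⟩
    rw [map_mul, map_inv₀, hFn, hFn, ← key, inv_mul_cancel_left₀ (hg0 _ (mul_ne_zero hr₁ hr'))]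
  refine ⟨AlgEquiv.ofBijective { F with commutes' := fun c => ?_ } hF⟩
  change F (OreLocalization.numeratorHom (algebraMap k R c)) = ιS (algebraMap k S c)
  rw [hFn]
  simp [g]

end SkewFrac

/-! ### Commutators and conjugates of differential operators -/

section Basic

variable {k : Type*} [Field k] {A : Type*} [CommRing A] [Algebra k A]

theorem mem_diffOpsOfOrder_zero_of_commute {d : Module.End k A}
    (h : ∀ b : A, d * Algebra.lmul k A b - Algebra.lmul k A b * d = 0) :
    d ∈ diffOpsOfOrder k A 0 := by
  refine ⟨d 1, LinearMap.ext fun b => ?_⟩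
  have := LinearMap.congr_fun (h b) 1
  simp only [LinearMap.sub_apply, Module.End.mul_apply, Algebra.coe_lmul_eq_mul,
    LinearMap.mul_apply_apply, mul_one, LinearMap.zero_apply, sub_eq_zero] at this
  simp [this, mul_comm]

theorem commutator_eq_zero_of_mem_zero {d : Module.End k A} (h : d ∈ diffOpsOfOrder k A 0) (b : A) :
    d * Algebra.lmul k A b - Algebra.lmul k A b * d = 0 := by
  obtain ⟨a, rfl⟩ := h
  rw [← map_mul, ← map_mul, mul_comm, sub_self]

theorem commutator_apply (d : Module.End k A) (b x : A) :
    (d * Algebra.lmul k A b - Algebra.lmul k A b * d) x = d (b * x) - b * d x := rfl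

theorem commutator_commutator_comm (d : Module.End k A) (b c : A) :
    (d * Algebra.lmul k A b - Algebra.lmul k A b * d) * Algebra.lmul k A c
      - Algebra.lmul k A c * (d * Algebra.lmul k A b - Algebra.lmul k A b * d)
    = (d * Algebra.lmul k A c - Algebra.lmul k A c * d) * Algebra.lmul k A b
      - Algebra.lmul k A b * (d * Algebra.lmul k A c - Algebra.lmul k A c * d) := by
  ext x
  simp only [LinearMap.sub_apply, Module.End.mul_apply, Algebra.coe_lmul_eq_mul,
    LinearMap.mul_apply_apply, mul_left_comm b c]
  ring

theorem conj_mem_diffOpsOfOrder (e : A ≃ₐ[k] A) {n : ℕ} {d : Module.End k A}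
    (hd : d ∈ diffOpsOfOrder k A n) :
    e.toLinearMap ∘ₗ d ∘ₗ e.symm.toLinearMap ∈ diffOpsOfOrder k A n := by
  induction n generalizing d with
  | zero =>
    obtain ⟨a, rfl⟩ := hd
    exact ⟨e a, LinearMap.ext fun x => by simp⟩
  | succ n ih =>
    intro b
    convert ih (hd (e.symm b)) using 1
    ext x
    simp

end Basic

/-! ### Differential operators along formally étale maps -/

section Etale

variable {k : Type*} [Field k] {B : Type*} [CommRing B] {K : Type*} [Field K] [Algebra k K]
  [Algebra B K]

/-- For `B → K` formally unramified, a differential operator on `K` commuting with `B` is a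
multiplication operator: inductively `x ↦ [d, x]` takes values in `K`, so it is a derivation of `K`
over `B`. -/
theorem mem_range_lmul_of_commute [Algebra.FormallyUnramified B K] {n : ℕ} {d : Module.End k K}
    (hd : d ∈ diffOpsOfOrder k K n)
    (h : ∀ b : B, Commute d (Algebra.lmul k K (algebraMap B K b))) :
    d ∈ diffOpsOfOrder k K 0 := by
  induction n generalizing d with
  | zero => exact hd
  | succ n ih =>
    have hx : ∀ x : K, d * Algebra.lmul k K x - Algebra.lmul k K x * d ∈ diffOpsOfOrder k K 0 := by
      intro x
      refine ih (hd x) fun b => ?_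
      rw [commute_iff_eq, ← sub_eq_zero, commutator_commutator_comm, sub_eq_zero.2 (h b).eq]
      simp
    have hB : ∀ (b : B) (x : K), d (algebraMap B K b * x) = algebraMap B K b * d x := fun b x =>
      LinearMap.congr_fun (h b).eq x
    have hxy : ∀ x y : K, d (x * y) - x * d y = (d x - x * d 1) * y := by
      intro x y
      obtain ⟨a, ha⟩ := hx x
      have h1 := LinearMap.congr_fun ha 1
      have h2 := LinearMap.congr_fun ha y
      rw [commutator_apply] at h1 h2
      simp only [Algebra.coe_lmul_eq_mul, LinearMap.mul_apply_apply, mul_one] at h1 h2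
      rw [← h2, h1]
    -- `x ↦ [d, x](1)` is a `B`-linear derivation of `K`, hence zero.
    let D : Derivation B K K := Derivation.mk'
      { toFun := fun x => d x - x * d 1
        map_add' := fun x y => by rw [map_add]; ring
        map_smul' := fun b x => by
          rw [Algebra.smul_def, hB, RingHom.id_apply, Algebra.smul_def]; ring } fun x y => by
        change d (x * y) - x * y * d 1 = x • (d y - y * d 1) + y • (d x - x * d 1)
        rw [smul_eq_mul, smul_eq_mul]
        linear_combination hxy x y
    have hD : D = 0 := by
      have := Algebra.FormallyUnramified.subsingleton_kaehlerDifferential (R := B) (A := K)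
      rw [← D.liftKaehlerDifferential_comp, Subsingleton.elim D.liftKaehlerDifferential 0]
      ext
      simp
    refine mem_diffOpsOfOrder_zero_of_commute fun x => LinearMap.ext fun y => ?_
    have : d x - x * d 1 = 0 := DFunLike.congr_fun hD x
    rw [commutator_apply, hxy, this, zero_mul]
    rfl

/-- A differential operator on `K` vanishing on `B` is zero: by induction on the order its
commutators with `B` are zero, so it is multiplication by its value at `1`. -/
theorem eq_zero_of_vanishing [Algebra.FormallyUnramified B K] {n : ℕ} {d : Module.End k K}
    (hd : d ∈ diffOpsOfOrder k K n) (h : ∀ b : B, d (algebraMap B K b) = 0) : d = 0 := by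
  have h0 : d ∈ diffOpsOfOrder k K 0 := by
    induction n generalizing d with
    | zero => exact hd
    | succ n ih =>
      refine mem_range_lmul_of_commute (B := B) hd fun b => ?_
      have hv : ∀ c : B, (d * Algebra.lmul k K (algebraMap B K b)
          - Algebra.lmul k K (algebraMap B K b) * d) (algebraMap B K c) = 0 := fun c => by
        rw [commutator_apply, ← map_mul, h, h, mul_zero, sub_zero]
      obtain ⟨a, ha⟩ := ih (hd (algebraMap B K b)) hv
      have h1 := hv 1
      rw [← ha] at h1
      obtain rfl : a = 0 := by simpa using h1
      rw [commute_iff_eq, ← sub_eq_zero, ← ha, map_zero]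
  obtain ⟨a, rfl⟩ := h0
  have := h 1
  obtain rfl : a = 0 := by simpa using this
  rw [map_zero]

theorem eq_of_eqOn [Algebra.FormallyUnramified B K] {d e : Module.End k K}
    (hd : d ∈ diffOps k K) (he : e ∈ diffOps k K)
    (h : ∀ b : B, d (algebraMap B K b) = e (algebraMap B K b)) : d = e := by
  obtain ⟨n, hn⟩ := sub_mem hd he
  exact sub_eq_zero.1 (eq_zero_of_vanishing (B := B) hn fun b => by simp [h b])

/-- The restriction to `B` of an operator of order at most `n` on `K` has order at most `n`. -/
theorem mem_diffOpsOfOrder_of_restrict [Algebra k B] (hinj : Function.Injective (algebraMap B K))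
    {n : ℕ} {d : Module.End k B} {e : Module.End k K} (he : e ∈ diffOpsOfOrder k K n)
    (h : ∀ b, e (algebraMap B K b) = algebraMap B K (d b)) : d ∈ diffOpsOfOrder k B n := by
  induction n generalizing d e with
  | zero =>
    obtain ⟨a, rfl⟩ := he
    refine ⟨d 1, LinearMap.ext fun b => hinj ?_⟩
    have h1 := h 1
    have h2 := h b
    simp at h1 h2 ⊢
    rw [← h1, h2]
  | succ n ih =>
    refine fun b => ih (he (algebraMap B K b)) fun c => ?_
    rw [commutator_apply, commutator_apply, ← map_mul, h, h, map_sub, map_mul _ b (d c)]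

/-- If `J` is a section of an augmentation `π : P → K` and `l : P → K` is `K`-linear and kills the
`(n + 1)`-st power of the augmentation ideal, then `l ∘ J` has order at most `n`: the commutator
with `x` is of the same shape, with `l` replaced by `l ((J x - x) * ·)`. -/
theorem comp_mem_diffOpsOfOrder {P : Type*} [CommRing P] [Algebra k P] [Algebra K P]
    [IsScalarTower k K P] (π : P →ₐ[K] K) (J : K →ₐ[k] P) (hJ : ∀ x, π (J x) = x) (n : ℕ)
    (l : P →ₗ[K] K) (hl : ∀ p ∈ RingHom.ker π ^ (n + 1), l p = 0) :
    (l.restrictScalars k) ∘ₗ J.toLinearMap ∈ diffOpsOfOrder k K n := by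
  induction n generalizing l with
  | zero =>
    refine ⟨l 1, LinearMap.ext fun x => ?_⟩
    have h := hl (J x - algebraMap K P x) (by simp [RingHom.mem_ker, hJ])
    rw [map_sub, sub_eq_zero, Algebra.algebraMap_eq_smul_one, map_smul] at h
    simp [h, mul_comm]
  | succ n ih =>
    intro x
    have hx : J x - algebraMap K P x ∈ RingHom.ker π := by simp [RingHom.mem_ker, hJ]
    convert ih (l ∘ₗ LinearMap.mulLeft K (J x - algebraMap K P x)) fun p hp => ?_ using 1
    · ext y
      rw [commutator_apply]
      simp [sub_mul, ← Algebra.smul_def]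
    · exact hl _ (by rw [pow_succ']; exact Ideal.mul_mem_mul hx hp)

variable [Algebra k B] [IsScalarTower k B K]

variable (k B K) in
/-- The multiplication map `K ⊗ B → K`. The powers of its kernel `I` define the jets: operators
`B → K` of order at most `n` are the `K`-linear forms on `(K ⊗ B) ⧸ I ^ (n + 1)`. -/
noncomputable def jetAugmentation : K ⊗[k] B →ₐ[K] K :=
  Algebra.TensorProduct.lift (Algebra.ofId K K) (IsScalarTower.toAlgHom k B K)
    fun _ _ => Commute.all _ _

@[simp]
theorem jetAugmentation_tmul (x : K) (b : B) :
    jetAugmentation k B K (x ⊗ₜ b) = x * algebraMap B K b := by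
  simp [jetAugmentation]

/-- The kernel of the multiplication map is generated by the elements `1 ⊗ b - b ⊗ 1`. -/
theorem sub_mem_span_jet (z : K ⊗[k] B) :
    z - jetAugmentation k B K z ⊗ₜ 1 ∈
      Ideal.span (Set.range fun b : B => (1 : K) ⊗ₜ[k] b - algebraMap B K b ⊗ₜ[k] (1 : B)) := by
  induction z with
  | zero => simp
  | add z w hz hw =>
    convert add_mem hz hw using 1
    rw [map_add, TensorProduct.add_tmul]; abel
  | tmul x b =>
    have : x ⊗ₜ[k] b - jetAugmentation k B K (x ⊗ₜ b) ⊗ₜ 1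
        = (x ⊗ₜ[k] (1 : B)) * ((1 : K) ⊗ₜ[k] b - algebraMap B K b ⊗ₜ[k] (1 : B)) := by
      rw [mul_sub]; simp
    rw [this]
    exact Ideal.mul_mem_left _ _ (Ideal.subset_span ⟨b, rfl⟩)

variable (K) in
/-- The `K`-linear extension `x ⊗ b ↦ x * d b` of `d : B → B` to `K ⊗ B`. -/
noncomputable def jetFunctional (d : Module.End k B) : K ⊗[k] B →ₗ[K] K :=
  ((IsScalarTower.toAlgHom k B K).toLinearMap ∘ₗ d).liftBaseChange K

@[simp]
theorem jetFunctional_tmul (d : Module.End k B) (x : K) (b : B) :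
    jetFunctional K d (x ⊗ₜ b) = x * algebraMap B K (d b) := by
  simp [jetFunctional]

theorem jetFunctional_commutator (d : Module.End k B) (b : B) (z : K ⊗[k] B) :
    jetFunctional K d (((1 : K) ⊗ₜ[k] b - algebraMap B K b ⊗ₜ[k] (1 : B)) * z)
      = jetFunctional K (d * Algebra.lmul k B b - Algebra.lmul k B b * d) z := by
  induction z with
  | zero => simp
  | add z w hz hw => rw [mul_add, map_add, map_add, hz, hw]
  | tmul x c =>
    rw [sub_mul, map_sub, jetFunctional_tmul, commutator_apply]
    simp
    ring

theorem jetFunctional_eq_zero {n : ℕ} {d : Module.End k B} (hd : d ∈ diffOpsOfOrder k B n)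
    {z : K ⊗[k] B} (hz : z ∈ RingHom.ker (jetAugmentation k B K) ^ (n + 1)) :
    jetFunctional K d z = 0 := by
  induction n generalizing d z with
  | zero =>
    obtain ⟨a, rfl⟩ := hd
    have : ∀ z : K ⊗[k] B, jetFunctional K (Algebra.lmul k B a) z
        = jetAugmentation k B K z * algebraMap B K a := by
      intro z
      induction z with
      | zero => simp
      | add z w hz hw => rw [map_add, map_add, hz, hw, add_mul]
      | tmul x b => simp; ring
    rw [zero_add, pow_one, RingHom.mem_ker] at hz
    rw [this, hz, zero_mul]
  | succ n ih =>
    rw [pow_succ'] at hz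
    induction hz using Submodule.mul_induction_on' with
    | add x _ y _ hx hy => rw [map_add, hx, hy, add_zero]
    | mem_mul_mem w hw t ht =>
      have h := sub_mem_span_jet w
      rw [RingHom.mem_ker.1 hw, TensorProduct.zero_tmul, sub_zero] at h
      clear hw
      induction h using Submodule.span_induction generalizing t with
      | mem x hx =>
        obtain ⟨b, rfl⟩ := hx
        rw [jetFunctional_commutator]
        exact ih (hd b) ht
      | zero => simp
      | add x y _ _ hx hy => rw [add_mul, map_add, hx t ht, hy t ht, add_zero]
      | smul r x _ hx =>
        rw [smul_eq_mul, mul_assoc, mul_left_comm]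
        exact hx _ (Ideal.mul_mem_left _ r ht)

/-- Here `P` carries no `B`-algebra structure in advance: the one used for lifting comes from `j`,
which in the application differs from the structure inherited from `K`. -/
theorem exists_section_of_formallySmooth [Algebra.FormallySmooth B K] {P : Type*} [CommRing P]
    (π : P →+* K) (hπ : IsNilpotent (RingHom.ker π)) (hsurj : Function.Surjective π) (j : B →+* P)
    (hj : ∀ b, π (j b) = algebraMap B K b) :
    ∃ J : K →+* P, (∀ b, J (algebraMap B K b) = j b) ∧ ∀ x, π (J x) = x := by
  let _ : Algebra B P := j.toAlgebra
  let π' : P →ₐ[B] K := { π with commutes' := hj }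
  let J := Algebra.FormallySmooth.liftOfSurjective (AlgHom.id B K) π' hsurj hπ
  exact ⟨J, fun b => J.commutes b,
    Algebra.FormallySmooth.liftOfSurjective_apply (AlgHom.id B K) π' hsurj hπ⟩

/-- A differential operator on `B` extends to `K` when `B → K` is formally smooth: `id : K → K`
lifts to a map from `K` to the `n`-jets `(K ⊗ B) ⧸ I ^ (n + 1)`, which is composed with the linear
form given by `d`. -/
theorem exists_extension [Algebra.FormallySmooth B K] {n : ℕ} {d : Module.End k B}
    (hd : d ∈ diffOpsOfOrder k B n) :
    ∃ e ∈ diffOpsOfOrder k K n, ∀ b, e (algebraMap B K b) = algebraMap B K (d b) := by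
  let I := RingHom.ker (jetAugmentation k B K)
  let P := (K ⊗[k] B) ⧸ I ^ (n + 1)
  let q : K ⊗[k] B →ₐ[K] P := Ideal.Quotient.mkₐ K (I ^ (n + 1))
  have hI : ∀ z ∈ I ^ (n + 1), jetAugmentation k B K z = 0 := fun z hz =>
    RingHom.mem_ker.1 (Ideal.pow_le_self (by omega) hz)
  let π : P →ₐ[K] K := Ideal.Quotient.liftₐ (I ^ (n + 1)) (jetAugmentation k B K) hI
  have hπq : ∀ z, π (q z) = jetAugmentation k B K z := fun z => rfl
  have hker : RingHom.ker π = I.map q := by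
    apply le_antisymm
    · intro p hp
      obtain ⟨z, rfl⟩ := Ideal.Quotient.mk_surjective p
      exact Ideal.mem_map_of_mem q (RingHom.mem_ker.2 (RingHom.mem_ker.1 hp))
    · rw [Ideal.map_le_iff_le_comap]
      exact fun z hz => hz
  have hnil : RingHom.ker π ^ (n + 1) = ⊥ := by
    rw [hker, ← Ideal.map_pow, Ideal.map_eq_bot_iff_le_ker]
    exact fun z hz => Ideal.Quotient.eq_zero_iff_mem.2 hz
  let j : B →ₐ[k] P := (q.restrictScalars k).comp Algebra.TensorProduct.includeRight
  have hj : ∀ b, π (j b) = algebraMap B K b := fun b => by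
    change jetAugmentation k B K (1 ⊗ₜ b) = _
    simp
  obtain ⟨J, hJB, hJ⟩ := exists_section_of_formallySmooth (B := B) (π : P →+* K) ⟨n + 1, hnil⟩
    (fun x => ⟨algebraMap K P x, by simp⟩) (j : B →+* P) hj
  let J' : K →ₐ[k] P := { J with
    commutes' := fun c => by
      change J (algebraMap k K c) = _
      rw [IsScalarTower.algebraMap_apply k B K, hJB]
      simp }
  let l : P →ₗ[K] K := Submodule.liftQ ((I ^ (n + 1)).restrictScalars K) (jetFunctional K d)
    fun z hz => jetFunctional_eq_zero hd hz
  refine ⟨_, comp_mem_diffOpsOfOrder π J' hJ n l fun p hp => ?_, fun b => ?_⟩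
  · rw [hnil, Ideal.mem_bot] at hp
    rw [hp, map_zero]
  · change l (J (algebraMap B K b)) = _
    rw [hJB]
    change jetFunctional K d (1 ⊗ₜ b) = _
    simp

variable (k B K) in
/-- Along a formally étale map `B → K`, extension of differential operators from `B` to `K` is a
homomorphism of algebras. -/
theorem exists_diffOps_algHom [Algebra.FormallyEtale B K] :
    ∃ φ : diffOps k B →ₐ[k] Module.End k K, (∀ d, φ d ∈ diffOps k K) ∧
      ∀ d b, φ d (algebraMap B K b) = algebraMap B K (d.1 b) := by
  have h : ∀ d : diffOps k B, ∃ e ∈ diffOps k K,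
      ∀ b, e (algebraMap B K b) = algebraMap B K (d.1 b) := by
    rintro ⟨d, n, hd⟩
    obtain ⟨e, he, h⟩ := exists_extension (K := K) hd
    exact ⟨e, ⟨n, he⟩, h⟩
  choose φ hφ hφB using h
  refine ⟨AlgHom.ofLinearMap
    { toFun := φ
      map_add' := fun d e => eq_of_eqOn (B := B) (hφ _) (add_mem (hφ _) (hφ _)) fun b => ?_
      map_smul' := fun c d => eq_of_eqOn (B := B) (hφ _) (Subalgebra.smul_mem _ (hφ _) c)
        fun b => ?_ }
    (eq_of_eqOn (B := B) (hφ _) (one_mem _) fun b => ?_)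
    (fun d e => eq_of_eqOn (B := B) (hφ _) (mul_mem (hφ _) (hφ _)) fun b => ?_), hφ, hφB⟩
  · simp [hφB]
  · rw [hφB, RingHom.id_apply, LinearMap.smul_apply, hφB]
    exact map_smul (IsScalarTower.toAlgHom k B K) c (d.1 b)
  · simp [hφB]
  · simp [hφB]

/-- If an operator on `K` sends `B` into the fractions of `B`, a single denominator suffices. By
induction on the order, clear the denominators of `s 1` and of the commutators of `s` with
generators of `B`. -/
theorem exists_smul_preserves [IsDomain B] [Algebra.FiniteType k B] {n : ℕ}
    {s : Module.End k K} (hs : s ∈ diffOpsOfOrder k K n)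
    (h : ∀ b : B, ∃ c : B, c ≠ 0 ∧
      algebraMap B K c * s (algebraMap B K b) ∈ (algebraMap B K).range) :
    ∃ c : B, c ≠ 0 ∧ ∀ b : B,
      algebraMap B K c * s (algebraMap B K b) ∈ (algebraMap B K).range := by
  classical
  induction n generalizing s with
  | zero =>
    obtain ⟨a, rfl⟩ := hs
    obtain ⟨c, hc, h1⟩ := h 1
    refine ⟨c, hc, fun b => ?_⟩
    convert mul_mem h1 ⟨b, rfl⟩ using 1
    simp [mul_assoc]
  | succ n ih =>
    obtain ⟨X, hX⟩ := (Algebra.FiniteType.out : (⊤ : Subalgebra k B).FG)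
    have hx : ∀ x : B, ∃ c : B, c ≠ 0 ∧ ∀ b : B, algebraMap B K c *
        (s * Algebra.lmul k K (algebraMap B K x) - Algebra.lmul k K (algebraMap B K x) * s)
          (algebraMap B K b) ∈ (algebraMap B K).range := by
      intro x
      refine ih (hs (algebraMap B K x)) fun b => ?_
      obtain ⟨c, hc, h1⟩ := h (x * b)
      obtain ⟨c', hc', h2⟩ := h b
      refine ⟨c * c', mul_ne_zero hc hc', ?_⟩
      convert sub_mem (mul_mem (⟨c', rfl⟩ : _ ∈ (algebraMap B K).range) h1)
        (mul_mem (⟨c * x, rfl⟩ : _ ∈ (algebraMap B K).range) h2) using 1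
      rw [commutator_apply, map_mul _ c c', map_mul _ x b, map_mul _ c x]
      ring
    choose cx hcx0 hcx using hx
    obtain ⟨c₁, hc₁, h1⟩ := h 1
    refine ⟨c₁ * ∏ x ∈ X, cx x, mul_ne_zero hc₁ (Finset.prod_ne_zero_iff.2 fun x _ => hcx0 x), ?_⟩
    set c := c₁ * ∏ x ∈ X, cx x with hc
    have hstep : ∀ x : B, ∀ b : B, x ∈ X →
        algebraMap B K c * s (algebraMap B K b) ∈ (algebraMap B K).range →
        algebraMap B K c * s (algebraMap B K (x * b)) ∈ (algebraMap B K).range := by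
      intro x b hxX hb
      obtain ⟨c', hc'⟩ : cx x ∣ c := (Finset.dvd_prod_of_mem cx hxX).mul_left c₁
      convert add_mem (mul_mem (⟨x, rfl⟩ : _ ∈ (algebraMap B K).range) hb)
        (mul_mem (⟨c', rfl⟩ : _ ∈ (algebraMap B K).range) (hcx x b)) using 1
      rw [commutator_apply, hc', map_mul _ (cx x) c', map_mul _ x b]
      ring
    -- The functions preserving the set of good `b` form a subalgebra containing the generators.
    let T : Subalgebra k B :=
      { carrier := {x | ∀ b, algebraMap B K c * s (algebraMap B K b) ∈ (algebraMap B K).range →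
          algebraMap B K c * s (algebraMap B K (x * b)) ∈ (algebraMap B K).range}
        mul_mem' := fun {x y} hx hy b hb => by rw [mul_assoc]; exact hx _ (hy _ hb)
        add_mem' := fun {x y} hx hy b hb => by
          rw [add_mul, map_add, map_add, mul_add]; exact add_mem (hx b hb) (hy b hb)
        algebraMap_mem' := fun r b hb => by
          have : algebraMap B K (algebraMap k B r * b) = r • algebraMap B K b := by
            rw [map_mul, ← IsScalarTower.algebraMap_apply, Algebra.smul_def]
          rw [this, map_smul, Algebra.smul_def, mul_left_comm, IsScalarTower.algebraMap_apply k B K]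
          exact mul_mem ⟨_, rfl⟩ hb }
    have hT : T = ⊤ := by
      rw [eq_top_iff, ← hX, Algebra.adjoin_le_iff]
      exact fun x hx b hb => hstep x b hx hb
    intro b
    have hb : b ∈ T := hT ▸ Algebra.mem_top
    have := hb 1 (by
      rw [hc, mul_comm c₁, map_mul, mul_assoc]
      exact mul_mem ⟨_, rfl⟩ h1)
    rwa [mul_one] at this

/-- An operator on `K` that sends `B` into `B` after multiplication by `c` restricts to a
differential operator on `B`. -/
theorem exists_restrict (hinj : Function.Injective (algebraMap B K))
    {s : Module.End k K} (hs : s ∈ diffOps k K) {c : B}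
    (hc : ∀ b : B, algebraMap B K c * s (algebraMap B K b) ∈ (algebraMap B K).range) :
    ∃ d ∈ diffOps k B, ∀ b,
      algebraMap B K (d b) = algebraMap B K c * s (algebraMap B K b) := by
  choose f hf using hc
  let d : Module.End k B :=
    { toFun := f
      map_add' := fun x y => hinj (by rw [map_add, hf, hf, hf, map_add, map_add, mul_add])
      map_smul' := fun r x => hinj (by
        have h1 : ∀ y : B, algebraMap B K (r • y) = r • algebraMap B K y := fun y =>
          map_smul (IsScalarTower.toAlgHom k B K) r y
        rw [RingHom.id_apply, h1, hf, hf, h1, map_smul, mul_smul_comm]) }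
  obtain ⟨n, hn⟩ := mul_mem
    (⟨0, algebraMap B K c, rfl⟩ : Algebra.lmul k K (algebraMap B K c) ∈ diffOps k K) hs
  exact ⟨d, ⟨n, mem_diffOpsOfOrder_of_restrict hinj hn fun b => (hf b).symm⟩, hf⟩

end Etale

/-! ### The common function field of birational affine schemes -/

section FunctionField

open CategoryTheory AlgebraicGeometry

/-- For an open immersion of an integral scheme `W` into an affine scheme `Spec R`, the stalk of `W`
at the generic point is a fraction field of `R`. -/
theorem isFractionRing_stalk_of_isOpenImmersion {R : CommRingCat.{0}} [IsDomain R]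
    {W : Scheme.{0}} [IsIntegral W] (f : W ⟶ Spec R) [IsOpenImmersion f] :
    @IsFractionRing R _ (W.presheaf.stalk (genericPoint W)) _
      (Spec.preimage (W.fromSpecStalk (genericPoint W) ≫ f)).hom.toAlgebra := by
  set ξ := genericPoint W
  let p : PrimeSpectrum R := f ξ
  let τ : R ⟶ (Spec R).presheaf.stalk (f ξ) := StructureSheaf.toStalk R p
  have hφ : Spec.preimage (W.fromSpecStalk ξ ≫ f) = τ ≫ f.stalkMap ξ := by
    apply Spec.map_injective
    have h : (Spec R).fromSpecStalk (f ξ) = Spec.map τ := Spec.fromSpecStalk_eq' R (f ξ)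
    rw [Spec.map_preimage, Spec.map_comp, ← h, Scheme.SpecMap_stalkMap_fromSpecStalk]
  rw [hφ]
  let _ : Algebra R ((Spec R).presheaf.stalk (f ξ)) := τ.hom.toAlgebra
  let _ : Algebra R (W.presheaf.stalk ξ) := (τ ≫ f.stalkMap ξ).hom.toAlgebra
  have hloc : IsLocalization.AtPrime ((Spec R).presheaf.stalk (f ξ)) p.asIdeal :=
    StructureSheaf.IsLocalization.to_stalk R p
  have hM : p.asIdeal.primeCompl = nonZeroDivisors R := by
    have hp : p = ⊥ :=
      (genericPoint_eq_of_isOpenImmersion f).trans (genericPoint_eq_bot_of_affine R)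
    rw [hp]
    ext
    exact mem_nonZeroDivisors_iff_ne_zero.symm
  let E : (Spec R).presheaf.stalk (f ξ) ≃+* W.presheaf.stalk ξ :=
    (asIso (f.stalkMap ξ)).commRingCatIsoToRingEquiv
  let E' : (Spec R).presheaf.stalk (f ξ) ≃ₐ[R] W.presheaf.stalk ξ :=
    AlgEquiv.ofRingEquiv (f := E) fun r => rfl
  have := IsLocalization.isLocalization_of_algEquiv p.asIdeal.primeCompl E'
  rwa [hM] at this

/-- The common fraction field is the stalk at the generic point of the common open subscheme. -/
theorem exists_common_fractionField {A B : Type} [CommRing A] [IsDomain A] [Algebra ℂ A]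
    [CommRing B] [IsDomain B] [Algebra ℂ B]
    (h : BirationallyEquivalent (complexSpec A) (complexSpec B)) :
    ∃ (M : Type) (_ : Field M) (_ : Algebra A M) (_ : Algebra B M),
      IsFractionRing A M ∧ IsFractionRing B M ∧
        ∀ c : ℂ, algebraMap A M (algebraMap ℂ A c) = algebraMap B M (algebraMap ℂ B c) := by
  obtain ⟨U, V, hU, hV, e, he⟩ := h
  have : Nonempty U := hU.nonempty.to_subtype
  have : IsIntegral U.toScheme := inferInstance
  let ξ := genericPoint U.toScheme
  let φ := Spec.preimage (U.toScheme.fromSpecStalk ξ ≫ U.ι)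
  let ψ := Spec.preimage (U.toScheme.fromSpecStalk ξ ≫ e.hom ≫ V.ι)
  have hcomp : CommRingCat.ofHom (algebraMap ℂ A) ≫ φ
      = CommRingCat.ofHom (algebraMap ℂ B) ≫ ψ := by
    apply Spec.map_injective
    rw [Spec.map_comp, Spec.map_comp, Spec.map_preimage, Spec.map_preimage]
    change _ ≫ complexSpec A = _ ≫ complexSpec B
    simp only [Category.assoc]
    rw [he]
  refine ⟨U.toScheme.functionField, inferInstance, φ.hom.toAlgebra, ψ.hom.toAlgebra,
    isFractionRing_stalk_of_isOpenImmersion U.ι,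
    isFractionRing_stalk_of_isOpenImmersion (e.hom ≫ V.ι), fun c => ?_⟩
  exact congrArg (fun f => f.hom c) hcomp

end FunctionField

/-! ### The Ore property for rings of differential operators -/

section Ore

variable {k : Type*} [Field k] {K : Type*} [Field K] [Algebra k K]

/-- A subalgebra of the differential operators on `K` is an Ore domain as soon as it contains
finitely many multiplication operators whose joint centralizer consists of multiplication
operators. The derivations are the commutators with these elements; they are nilpotent because they
lower the order. -/
theorem isOreDomain_of_embedding [CharZero k] {R : Type*} [Ring R] [Algebra k R]
    (j : R →ₐ[k] Module.End k K) (hj : Function.Injective j) (hD : ∀ r, j r ∈ diffOps k K)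
    {ι : Type*} [Finite ι] (x : ι → R) (y : ι → K) (hx : ∀ i, j (x i) = Algebra.lmul k K (y i))
    (hc : ∀ d ∈ diffOps k K, (∀ i, Commute d (Algebra.lmul k K (y i))) →
      d ∈ diffOpsOfOrder k K 0) : IsOreDomain R := by
  have : Nontrivial R := j.toRingHom.domain_nontrivial
  have : IsAddTorsionFree R := ⟨fun n hn a b h => by
    have h' : (n : k) • a = (n : k) • b := by
      rw [Nat.cast_smul_eq_nsmul, Nat.cast_smul_eq_nsmul]; exact h
    exact smul_right_injective R (Nat.cast_ne_zero.2 hn) h'⟩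
  let δ : ι → R →+ R := fun i => AddMonoidHom.mulRight (x i) - AddMonoidHom.mulLeft (x i)
  have hδ : ∀ i r, δ i r = r * x i - x i * r := fun i r => rfl
  have hxx : ∀ i i', x i * x i' = x i' * x i := fun i i' => hj (by
    rw [map_mul, map_mul, hx, hx, ← map_mul, ← map_mul, mul_comm])
  have hker : ∀ r, (∀ i, δ i r = 0) → ∃ a, Algebra.lmul k K a = j r := fun r hr =>
    hc (j r) (hD r) fun i => by
      rw [commute_iff_eq, ← hx, ← map_mul, ← map_mul]
      exact congrArg j (sub_eq_zero.1 (hr i))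
  refine isOreDomain_of_derivations δ ?_ ?_ ?_ ?_ ?_
  · intro i a b
    simp only [hδ]
    noncomm_ring
  · intro i i' a
    simp only [hδ, sub_mul, mul_sub, mul_assoc, hxx i' i]
    simp only [← mul_assoc, hxx i' i]
    abel
  · intro i a
    obtain ⟨n, hn⟩ := hD a
    refine ⟨n + 1, hj ?_⟩
    rw [map_zero]
    generalize hd : j a = d at hn
    induction n generalizing a d with
    | zero =>
      change j (δ i a) = 0
      rw [hδ, map_sub, map_mul, map_mul, hx, hd, commutator_eq_zero_of_mem_zero hn]
    | succ n ih =>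
      rw [Function.iterate_succ_apply]
      refine ih (δ i a) _ ?_ (hn (y i))
      rw [hδ, map_sub, map_mul, map_mul, hx, hd]
  · intro a b ha hb
    obtain ⟨u, hu⟩ := hker a ha
    obtain ⟨v, hv⟩ := hker b hb
    apply hj
    rw [map_mul, map_mul, ← hu, ← hv, ← map_mul, ← map_mul, mul_comm]
  · intro a b ha hb ha0 hb0 h0
    obtain ⟨u, hu⟩ := hker a ha
    obtain ⟨v, hv⟩ := hker b hb
    have h := congrArg j h0
    rw [map_mul, ← hu, ← hv, ← map_mul, map_zero] at h
    have huv : u * v = 0 := by simpa using LinearMap.congr_fun h 1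
    rcases mul_eq_zero.1 huv with rfl | rfl
    · exact ha0 (hj (by rw [← hu, map_zero, map_zero]))
    · exact hb0 (hj (by rw [← hv, map_zero, map_zero]))

theorem commute_lmul_of_mul_eq {d : Module.End k K} {q x p : K} (hq : q ≠ 0)
    (hdq : Commute d (Algebra.lmul k K q)) (hdp : Commute d (Algebra.lmul k K p))
    (h : q * x = p) : Commute d (Algebra.lmul k K x) := by
  let u : (Module.End k K)ˣ := Units.map (Algebra.lmul k K : K →* Module.End k K) (Units.mk0 q hq)
  have hx : x = ↑(Units.mk0 q hq)⁻¹ * p := by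
    rw [Units.eq_inv_mul_iff_mul_eq]; exact h
  have hu : Commute d ↑u⁻¹ := Commute.units_inv_right hdq
  rw [hx, map_mul]
  exact hu.mul_right hdp

variable {B : Type*} [CommRing B] [Algebra k B] [Algebra B K] [IsScalarTower k B K]

theorem mem_diffOpsOfOrder_zero_of_commute_generators [Algebra.FormallyUnramified B K] {X : Set B}
    (hX : Algebra.adjoin k X = ⊤) {d : Module.End k K} (hd : d ∈ diffOps k K)
    (h : ∀ x ∈ X, Commute d (Algebra.lmul k K (algebraMap B K x))) :
    d ∈ diffOpsOfOrder k K 0 := by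
  obtain ⟨n, hn⟩ := hd
  refine mem_range_lmul_of_commute (B := B) hn fun b => ?_
  have hle : Algebra.adjoin k X ≤ (Subalgebra.centralizer k {d}).comap
      ((Algebra.lmul k K).comp (IsScalarTower.toAlgHom k B K)) := by
    rw [Algebra.adjoin_le_iff]
    intro x hx
    rintro _ rfl
    exact (h x hx).eq
  have hb : b ∈ Algebra.adjoin k X := hX ▸ Algebra.mem_top
  exact hle hb d rfl

end Ore

/-! ### Invariants of a finite group and the fraction field -/

section Invariants

variable {k : Type*} [Field k] {A : Type*} [CommRing A] [Algebra k A] {G : Type*} [Group G]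

theorem mem_invariantDiffOps_iff {ρ : G →* (A ≃ₐ[k] A)} {d : Module.End k A} :
    d ∈ invariantDiffOps ρ ↔ d ∈ diffOps k A ∧ ∀ g a, d (ρ g a) = ρ g (d a) := by
  refine and_congr_right fun _ => forall_congr' fun g => ⟨fun h a => ?_, fun h => ?_⟩
  · have := LinearMap.congr_fun h (ρ g a)
    simpa [AlgEquiv.aut_inv] using this.symm
  · ext a
    simp [← h, AlgEquiv.aut_inv]

theorem lmul_mem_invariantDiffOps {ρ : G →* (A ≃ₐ[k] A)} {a : A} (ha : ∀ g, ρ g a = a) :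
    Algebra.lmul k A a ∈ invariantDiffOps ρ :=
  mem_invariantDiffOps_iff.2 ⟨⟨0, a, rfl⟩, fun g b => by simp [ha]⟩

/-- The norm of `s` is a nonzero invariant multiple of `s`. -/
theorem exists_invariant_multiple [IsDomain A] [Finite G] (ρ : G →* (A ≃ₐ[k] A)) {s : A}
    (hs : s ≠ 0) : ∃ N : A, N ≠ 0 ∧ (∀ g, ρ g N = N) ∧ s ∣ N := by
  cases nonempty_fintype G
  refine ⟨∏ g : G, ρ g s, ?_, fun g => ?_, ?_⟩
  · exact Finset.prod_ne_zero_iff.2 fun g _ => (map_ne_zero_iff _ (ρ g).injective).2 hs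
  · rw [map_prod]
    refine Fintype.prod_equiv (Equiv.mulLeft g) _ _ fun h => ?_
    simp
  · have : s = ρ 1 s := by simp
    rw [this]
    simpa using Finset.dvd_prod_of_mem (fun g : G => ρ g s) (Finset.mem_univ 1)

variable (K : Type*) [Field K] [Algebra k K] [Algebra A K]

theorem exists_action_fractionField [IsScalarTower k A K] [IsFractionRing A K]
    (ρ : G →* (A ≃ₐ[k] A)) :
    ∃ ρK : G →* (K ≃ₐ[k] K), ∀ g a, ρK g (algebraMap A K a) = algebraMap A K (ρ g a) := by
  let F : G → K ≃+* K := fun g => IsFractionRing.ringEquivOfRingEquivHom A K (ρ g).toRingEquiv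
  have hF : ∀ g a, F g (algebraMap A K a) = algebraMap A K (ρ g a) := fun g a =>
    IsFractionRing.ringEquivOfRingEquiv_algebraMap (ρ g).toRingEquiv a
  let H : G → K ≃ₐ[k] K := fun g => AlgEquiv.ofRingEquiv (f := F g) fun c => by
    rw [IsScalarTower.algebraMap_apply k A K, hF, AlgEquiv.commutes]
  have hH : ∀ g a, H g (algebraMap A K a) = algebraMap A K (ρ g a) := hF
  have ext : ∀ e e' : K ≃ₐ[k] K, (∀ a, e (algebraMap A K a) = e' (algebraMap A K a)) → e = e' := by
    intro e e' h
    ext x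
    obtain ⟨a, s, -, rfl⟩ := IsFractionRing.div_surjective (A := A) x
    rw [map_div₀, map_div₀, h, h]
  exact ⟨{ toFun := H
           map_one' := ext _ _ fun a => by rw [hH]; simp
           map_mul' := fun g h => ext _ _ fun a => by
            rw [hH, AlgEquiv.mul_apply, hH, hH, map_mul, AlgEquiv.mul_apply] }, hH⟩

variable {K}

/-- The invariants of `Frac A` are fractions of invariants of `A`. -/
theorem exists_invariant_fraction [IsDomain A] [IsFractionRing A K] [Finite G]
    {ρ : G →* (A ≃ₐ[k] A)} {ρK : G →* (K ≃ₐ[k] K)}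
    (hρ : ∀ g a, ρK g (algebraMap A K a) = algebraMap A K (ρ g a)) {x : K}
    (hx : ∀ g, ρK g x = x) :
    ∃ p q : A, (∀ g, ρ g p = p) ∧ (∀ g, ρ g q = q) ∧ q ≠ 0 ∧
      algebraMap A K q * x = algebraMap A K p := by
  obtain ⟨a, s, hs, rfl⟩ := IsFractionRing.div_surjective (A := A) x
  have hs0 : algebraMap A K s ≠ 0 := by simpa using nonZeroDivisors.ne_zero hs
  obtain ⟨N, hN0, hN, t, rfl⟩ := exists_invariant_multiple ρ (nonZeroDivisors.ne_zero hs)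
  have h : algebraMap A K (s * t) * (algebraMap A K a / algebraMap A K s)
      = algebraMap A K (a * t) := by
    rw [map_mul, map_mul]; field_simp
  refine ⟨a * t, s * t, fun g => IsFractionRing.injective A K ?_, hN, hN0, h⟩
  rw [← hρ, ← h, map_mul, hx, hρ, hN]

/-- The extension of an equivariant operator is equivariant, by uniqueness of extensions. -/
theorem extension_equivariant [Algebra.FormallyUnramified A K] {σ : K ≃ₐ[k] K} {τ : A ≃ₐ[k] A}
    (h : ∀ a, σ (algebraMap A K a) = algebraMap A K (τ a)) {d : Module.End k A}
    {e : Module.End k K} (he : e ∈ diffOps k K)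
    (hde : ∀ a, e (algebraMap A K a) = algebraMap A K (d a)) (hd : ∀ a, d (τ a) = τ (d a)) (x : K) :
    e (σ x) = σ (e x) := by
  have hσ : ∀ a, σ.symm (algebraMap A K a) = algebraMap A K (τ.symm a) := fun a => by
    rw [AlgEquiv.symm_apply_eq, h, AlgEquiv.apply_symm_apply]
  have key : σ.toLinearMap ∘ₗ e ∘ₗ σ.symm.toLinearMap = e := by
    obtain ⟨n, hn⟩ := he
    refine eq_of_eqOn (B := A) ⟨n, conj_mem_diffOpsOfOrder σ hn⟩ ⟨n, hn⟩ fun a => ?_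
    simp [hσ, hde, h, ← hd]
  conv_lhs => rw [← key]
  simp

end Invariants

/-! ### Embedding into the invariant operators on the fraction field -/

section Comparison

variable {k : Type*} [Field k] {A : Type*} [CommRing A] [IsDomain A] [Algebra k A]
  [Algebra.FiniteType k A] {G : Type*} [Group G] {ρ : G →* (A ≃ₐ[k] A)}
  {K : Type*} [Field K] [Algebra k K] [Algebra A K] [IsScalarTower k A K] [IsFractionRing A K]
  {ρK : G →* (K ≃ₐ[k] K)}
  {B : Type*} [CommRing B] [IsDomain B] [Algebra k B] [Algebra.FiniteType k B]
  [Algebra B K] [IsScalarTower k B K]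

/-- `D(A)^G` embeds into `D(K)^G`, and left denominators from `A^G` clear `D(K)^G` into `D(A)^G`. -/
theorem exists_invariantDiffOps_algHom [Finite G]
    (hρ : ∀ g a, ρK g (algebraMap A K a) = algebraMap A K (ρ g a)) :
    ∃ f : invariantDiffOps ρ →ₐ[k] invariantDiffOps ρK, Function.Injective f ∧
      (∀ d a, (f d).1 (algebraMap A K a) = algebraMap A K (d.1 a)) ∧
      ∀ s : invariantDiffOps ρK, ∃ r r' : invariantDiffOps ρ, r ≠ 0 ∧ f r * s = f r' := by
  have : Algebra.FormallyEtale A K := Algebra.FormallyEtale.of_isLocalization A⁰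
  have hinj : Function.Injective (algebraMap A K) := IsFractionRing.injective A K
  obtain ⟨φ, hφ, hφA⟩ := exists_diffOps_algHom k A K
  let f : invariantDiffOps ρ →ₐ[k] invariantDiffOps ρK :=
    (φ.comp (Subalgebra.inclusion fun d (hd : d ∈ invariantDiffOps ρ) =>
      (mem_invariantDiffOps_iff.1 hd).1)).codRestrict _ fun d =>
      mem_invariantDiffOps_iff.2 ⟨hφ _, fun g => extension_equivariant (hρ g) (hφ _) (hφA _)
        ((mem_invariantDiffOps_iff.1 d.2).2 g)⟩
  have hf : ∀ d a, (f d).1 (algebraMap A K a) = algebraMap A K (d.1 a) := fun d a => hφA _ a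
  refine ⟨f, fun d e h => ?_, hf, fun s => ?_⟩
  · ext a
    apply hinj
    rw [← hf, ← hf, h]
  · obtain ⟨hs, hsG⟩ := mem_invariantDiffOps_iff.1 s.2
    obtain ⟨n, hn⟩ := id hs
    obtain ⟨c, hc0, hc⟩ := exists_smul_preserves (B := A) hn fun a => by
      obtain ⟨p, q, hq, h⟩ := IsFractionRing.div_surjective (A := A) (s.1 (algebraMap A K a))
      have hq0 : algebraMap A K q ≠ 0 := by simpa using nonZeroDivisors.ne_zero hq
      exact ⟨q, nonZeroDivisors.ne_zero hq, p, by rw [← h]; field_simp⟩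
    obtain ⟨N, hN0, hN, t, rfl⟩ := exists_invariant_multiple ρ hc0
    obtain ⟨d, hd, hds⟩ := exists_restrict hinj hs (c := c * t) fun a => by
      rw [map_mul, mul_comm (algebraMap A K c), mul_assoc]
      exact mul_mem ⟨t, rfl⟩ (hc a)
    have hdG : ∀ g a, d (ρ g a) = ρ g (d a) := fun g a => hinj (by
      rw [hds, ← hρ, hsG, ← hρ, hds, map_mul (ρK g), hρ, hN])
    refine ⟨⟨_, lmul_mem_invariantDiffOps hN⟩, ⟨d, mem_invariantDiffOps_iff.2 ⟨hd, hdG⟩⟩,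
      fun h => hN0 ?_, Subtype.ext ?_⟩
    · simpa using LinearMap.congr_fun (congrArg Subtype.val h) 1
    · have h1 : (f ⟨_, lmul_mem_invariantDiffOps hN⟩).1
          = Algebra.lmul k K (algebraMap A K (c * t)) :=
        eq_of_eqOn (B := A) (f _).2.1 ⟨0, _, rfl⟩ fun a => by rw [hf]; simp
      refine eq_of_eqOn (B := A) (f _ * s).2.1 (f _).2.1 fun a => ?_
      rw [hf, hds, MulMemClass.coe_mul, h1]
      rfl

/-- `D(B)` embeds into `D(K)^G` if `B → K` is formally étale with image in `K^G`, and left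
denominators from `B` clear `D(K)^G` into `D(B)` if moreover `K^G` consists of fractions of `B`. -/
theorem exists_diffOps_algHom_invariantDiffOps [Algebra.FormallyEtale B K]
    (hinj : Function.Injective (algebraMap B K))
    (hfix : ∀ g b, ρK g (algebraMap B K b) = algebraMap B K b)
    (hfrac : ∀ x : K, (∀ g, ρK g x = x) →
      ∃ p q : B, q ≠ 0 ∧ algebraMap B K q * x = algebraMap B K p) :
    ∃ f : diffOps k B →ₐ[k] invariantDiffOps ρK, Function.Injective f ∧
      (∀ d b, (f d).1 (algebraMap B K b) = algebraMap B K (d.1 b)) ∧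
      ∀ s : invariantDiffOps ρK, ∃ r r' : diffOps k B, r ≠ 0 ∧ f r * s = f r' := by
  obtain ⟨φ, hφ, hφB⟩ := exists_diffOps_algHom k B K
  let f : diffOps k B →ₐ[k] invariantDiffOps ρK := φ.codRestrict _ fun d =>
    mem_invariantDiffOps_iff.2 ⟨hφ d, fun g =>
      extension_equivariant (τ := AlgEquiv.refl) (hfix g) (hφ d) (hφB d) fun _ => rfl⟩
  have hf : ∀ d b, (f d).1 (algebraMap B K b) = algebraMap B K (d.1 b) := hφB
  refine ⟨f, fun d e h => ?_, hf, fun s => ?_⟩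
  · ext b
    apply hinj
    rw [← hf, ← hf, h]
  · obtain ⟨hs, hsG⟩ := mem_invariantDiffOps_iff.1 s.2
    obtain ⟨n, hn⟩ := id hs
    obtain ⟨c, hc0, hc⟩ := exists_smul_preserves (B := B) hn fun b => by
      obtain ⟨p, q, hq, h⟩ := hfrac (s.1 (algebraMap B K b)) fun g => by rw [← hsG, hfix]
      exact ⟨q, hq, p, h.symm⟩
    obtain ⟨d, hd, hds⟩ := exists_restrict hinj hs hc
    refine ⟨⟨_, ⟨0, c, rfl⟩⟩, ⟨d, hd⟩, fun h => hc0 ?_, Subtype.ext ?_⟩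
    · simpa using LinearMap.congr_fun (congrArg Subtype.val h) 1
    · have h1 : (f ⟨_, ⟨0, c, rfl⟩⟩).1 = Algebra.lmul k K (algebraMap B K c) :=
        eq_of_eqOn (B := B) (f _).2.1 ⟨0, _, rfl⟩ fun a => by rw [hf]; simp
      refine eq_of_eqOn (B := B) (f _ * s).2.1 (f _).2.1 fun a => ?_
      rw [hf, hds, MulMemClass.coe_mul, h1]
      rfl

theorem exists_isOreDomain_and_skewFrac_equiv [CharZero k] [Finite G]
    [Algebra.FormallyEtale B K]
    (hρ : ∀ g a, ρK g (algebraMap A K a) = algebraMap A K (ρ g a))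
    (hinj : Function.Injective (algebraMap B K))
    (hfix : ∀ g b, ρK g (algebraMap B K b) = algebraMap B K b)
    (hfrac : ∀ x : K, (∀ g, ρK g x = x) →
      ∃ p q : B, q ≠ 0 ∧ algebraMap B K q * x = algebraMap B K p) :
    ∃ (_ : IsOreDomain (invariantDiffOps ρ)) (_ : IsOreDomain (diffOps k B)),
      Nonempty (SkewFrac (invariantDiffOps ρ) ≃ₐ[k] SkewFrac (diffOps k B)) := by
  have : Algebra.FormallyEtale A K := Algebra.FormallyEtale.of_isLocalization A⁰
  obtain ⟨X, hX⟩ := (Algebra.FiniteType.out : (⊤ : Subalgebra k B).FG)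
  obtain ⟨f, hfinj, hf, hfs⟩ := exists_invariantDiffOps_algHom hρ
  obtain ⟨f', hfinj', hf', hfs'⟩ := exists_diffOps_algHom_invariantDiffOps hinj hfix hfrac
  have hval : Function.Injective (invariantDiffOps ρK).val := Subtype.val_injective
  have oreB : IsOreDomain (diffOps k B) :=
    isOreDomain_of_embedding ((invariantDiffOps ρK).val.comp f') (hval.comp hfinj')
      (fun d => (f' d).2.1) (fun x : X => ⟨Algebra.lmul k B x, 0, x, rfl⟩)
      (fun x => algebraMap B K x)
      (fun x => eq_of_eqOn (B := B) (f' _).2.1 ⟨0, _, rfl⟩ fun a =>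
        (hf' _ a).trans (by simp))
      fun d hd h => mem_diffOpsOfOrder_zero_of_commute_generators hX hd fun x hx => h ⟨x, hx⟩
  have oreS : IsOreDomain (invariantDiffOps ρK) :=
    isOreDomain_of_embedding (invariantDiffOps ρK).val hval (fun d => d.2.1)
      (fun x : X => ⟨_, lmul_mem_invariantDiffOps fun g => hfix g x⟩)
      (fun x => algebraMap B K x) (fun _ => rfl)
      fun d hd h => mem_diffOpsOfOrder_zero_of_commute_generators hX hd fun x hx => h ⟨x, hx⟩
  have oreA : IsOreDomain (invariantDiffOps ρ) := by
    -- Numerators and denominators in `A^G` of the generators of `B` have the same centralizer.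
    choose p q hp hq hq0 hpq using fun b : B =>
      exists_invariant_fraction hρ (x := algebraMap B K b) fun g => hfix g b
    have hlmul : ∀ (a : A) (ha : ∀ g, ρ g a = a),
        (f ⟨_, lmul_mem_invariantDiffOps ha⟩).1 = Algebra.lmul k K (algebraMap A K a) :=
      fun a ha => eq_of_eqOn (B := A) (f _).2.1 ⟨0, _, rfl⟩ fun b => by rw [hf]; simp
    refine isOreDomain_of_embedding ((invariantDiffOps ρK).val.comp f) (hval.comp hfinj)
      (fun d => (f d).2.1)
      (Sum.elim (fun x : X => ⟨_, lmul_mem_invariantDiffOps (hp x)⟩)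
        fun x : X => ⟨_, lmul_mem_invariantDiffOps (hq x)⟩)
      (Sum.elim (fun x => algebraMap A K (p x)) fun x => algebraMap A K (q x))
      (by rintro (x | x); exacts [hlmul _ (hp x), hlmul _ (hq x)])
      fun d hd h => mem_diffOpsOfOrder_zero_of_commute_generators hX hd fun x hx => ?_
    exact commute_lmul_of_mul_eq (by simpa using hq0 x) (h (.inr ⟨x, hx⟩)) (h (.inl ⟨x, hx⟩))
      (hpq x)
  obtain ⟨e⟩ := nonempty_skewFrac_algEquiv (R := invariantDiffOps ρ)
    (S := invariantDiffOps ρK) f hfinj hfs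
  obtain ⟨e'⟩ := nonempty_skewFrac_algEquiv (R := diffOps k B)
    (S := invariantDiffOps ρK) f' hfinj' hfs'
  exact ⟨oreA, oreB, ⟨e.trans e'.symm⟩⟩

end Comparison

theorem theorem1p2
    (A : Type) [CommRing A] [IsDomain A] [Algebra ℂ A] [Algebra.FiniteType ℂ A]
    (G : Type*) [Group G] [Finite G] (ρ : G →* (A ≃ₐ[ℂ] A))
    (B : Type) [CommRing B] [IsDomain B] [Algebra ℂ B] [Algebra.FiniteType ℂ B]
    (hbir : BirationallyEquivalent (complexSpec (invariantFunctions ρ)) (complexSpec B)) :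
    ∃ (_ : IsOreDomain (invariantDiffOps ρ)) (_ : IsOreDomain (diffOps ℂ B)),
      Nonempty (SkewFrac (invariantDiffOps ρ) ≃ₐ[ℂ] SkewFrac (diffOps ℂ B)) := by
  obtain ⟨M, _, _, _, hAM, hBM, hℂ⟩ := exists_common_fractionField hbir
  let K := FractionRing A
  obtain ⟨ρK, hρ⟩ := exists_action_fractionField K ρ
  -- The inclusion of `A^G` into `K` extends to its fraction field `M`; `B` maps to `K` through `M`.
  let A₀ := invariantFunctions ρ
  have hA₀K : Function.Injective (algebraMap A₀ K) :=
    (IsFractionRing.injective A K).comp Subtype.val_injective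
  let _ : Algebra M K := (IsFractionRing.lift hA₀K).toAlgebra
  have hMK : ∀ a : A₀, algebraMap M K (algebraMap A₀ M a) = algebraMap A K a.1 :=
    IsFractionRing.lift_algebraMap hA₀K
  let _ : Algebra B K := ((algebraMap M K).comp (algebraMap B M)).toAlgebra
  have : IsScalarTower B M K := .of_algebraMap_eq fun _ => rfl
  have : IsScalarTower ℂ B K := .of_algebraMap_eq fun c => by
    change _ = algebraMap M K (algebraMap B M (algebraMap ℂ B c))
    rw [← hℂ, hMK, IsScalarTower.algebraMap_apply ℂ A K]
    rfl
  have hfixM : ∀ g m, ρK g (algebraMap M K m) = algebraMap M K m := by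
    intro g m
    obtain ⟨a, s, -, rfl⟩ := IsFractionRing.div_surjective (A := A₀) m
    rw [map_div₀, map_div₀, hMK, hMK, hρ, hρ, a.2 g, s.2 g]
  have hfixed : ∀ x : K, (∀ g, ρK g x = x) → ∃ m, algebraMap M K m = x := by
    intro x hx
    obtain ⟨p, q, hp, hq, hq0, h⟩ := exists_invariant_fraction hρ hx
    have hq' : algebraMap A K q ≠ 0 := by simpa using hq0
    refine ⟨algebraMap A₀ M ⟨p, hp⟩ / algebraMap A₀ M ⟨q, hq⟩, ?_⟩
    rw [map_div₀, hMK, hMK, div_eq_iff hq', ← h, mul_comm]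
  have : Algebra.FormallyEtale B M := Algebra.FormallyEtale.of_isLocalization B⁰
  have : CharZero M := charZero_of_injective_ringHom
    ((algebraMap B M).comp (algebraMap ℂ B)).injective
  have : Algebra.IsIntegral M K := by
    let _ : MulSemiringAction G K := MulSemiringAction.compHom K ρK
    have : Algebra.IsInvariant M K G := ⟨hfixed⟩
    exact Algebra.IsInvariant.isIntegral M K G
  have : Algebra.FormallyEtale M K := Algebra.FormallyEtale.of_isSeparable M K
  have : Algebra.FormallyEtale B K := .comp B M K
  refine exists_isOreDomain_and_skewFrac_equiv hρ
    ((algebraMap M K).injective.comp (IsFractionRing.injective B M))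
    (fun g b => hfixM g _) fun x hx => ?_
  obtain ⟨m, rfl⟩ := hfixed x hx
  obtain ⟨p, q, hq, rfl⟩ := IsFractionRing.div_surjective (A := B) m
  have hq0 : algebraMap B M q ≠ 0 := by simpa using nonZeroDivisors.ne_zero hq
  refine ⟨p, q, nonZeroDivisors.ne_zero hq, ?_⟩
  change algebraMap M K (algebraMap B M q) * _ = algebraMap M K (algebraMap B M p)
  rw [← map_mul, mul_div_cancel₀ _ hq0]
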